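/- Let $0\le m\le n$ be integers. Let $S(n)$ be the group of permutations of $\{1,\dots,n\}$, let $S_m(n)\subseteq S(n)$ be the subgroup of permutations fixing each of $1,\dots,m$ (so $S_0(n)=S(n)$), and let $B_m(n)$ be the centralizer of $S_m(n)$ in the group algebra $\mathbb{C}[S(n)]$; in particular $B_0(n)$ is the center of $\mathbb{C}[S(n)]$. Let $\mathcal H_m$ be the degenerate affine Hecke algebra, that is, the unital associative $\mathbb{C}$-algebra with generators $s_1,\dots,s_{m-1}$ and $u_1,\dots,u_m$ and defining relations $$s_k^2=1,\qquad s_ks_{k+1}s_k=s_{k+1}s_ks_{k+1},\qquad s_ks_l=s_ls_k\ \ (|k-l|>1),$$ $$s_ku_k=u_{k+1}s_k+1,\qquad s_ku_l=u_ls_k\ \ (l\ne k,k+1),\qquad u_ku_l=u_lu_k .$$ Then there is a unique homomorphism of unital $\mathbb{C}$-algebras $\varphi:\mathcal H_m\to B_m(n)$ such that $$\varphi(s_k)=(k,k+1)\quad(1\le k\le m-1),\qquad \varphi(u_k)=\sum_{i=k+1}^{n}(k\,i)\quad(1\le k\le m),$$ and the algebra $B_m(n)$ is generated by $B_0(n)$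 and the image of $\varphi$. -/

import Mathlib

/-- `S_m(n)`: the permutations of the `n` points `0, …, n - 1` that fix each of the first `m` points. -/
def symmFix (m n : ℕ) : Subgroup (Equiv.Perm (Fin n)) :=
  fixingSubgroup (Equiv.Perm (Fin n)) {i : Fin n | (i : ℕ) < m}

/-- A permutation as an element of the group algebra `ℂ[S(n)]`. -/
noncomputable def permElt {n : ℕ} (σ : Equiv.Perm (Fin n)) :
    MonoidAlgebra ℂ (Equiv.Perm (Fin n)) :=
  MonoidAlgebra.of ℂ (Equiv.Perm (Fin n)) σ

/-- `B_m(n)`: the centralizer of `S_m(n)` in the group algebra `ℂ[S(n)]`. -/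
noncomputable def centralizerAlg (m n : ℕ) :
    Subalgebra ℂ (MonoidAlgebra ℂ (Equiv.Perm (Fin n))) :=
  Subalgebra.centralizer ℂ (permElt '' (symmFix m n : Set (Equiv.Perm (Fin n))))

/-- Generators of the degenerate affine Hecke algebra `H_m`, indexed from `0`:
`s_k` for `k + 1 < m` and `u_k` for `k < m`. -/
inductive DegHeckeGen (m : ℕ) : Type
  | s (k : ℕ) (hk : k + 1 < m) : DegHeckeGen m
  | u (k : ℕ) (hk : k < m) : DegHeckeGen m

namespace DegHeckeGen

/-- The generator `s_k` in the free algebra. -/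
noncomputable def fs {m : ℕ} (k : ℕ) (hk : k + 1 < m) : FreeAlgebra ℂ (DegHeckeGen m) :=
  FreeAlgebra.ι ℂ (DegHeckeGen.s k hk)

/-- The generator `u_k` in the free algebra. -/
noncomputable def fu {m : ℕ} (k : ℕ) (hk : k < m) : FreeAlgebra ℂ (DegHeckeGen m) :=
  FreeAlgebra.ι ℂ (DegHeckeGen.u k hk)

end DegHeckeGen

open DegHeckeGen in
/-- The defining relations of the degenerate affine Hecke algebra `H_m`. -/
inductive DegHeckeRel (m : ℕ) :
    FreeAlgebra ℂ (DegHeckeGen m) → FreeAlgebra ℂ (DegHeckeGen m) → Prop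
  | s_sq (k : ℕ) (hk : k + 1 < m) :
      DegHeckeRel m (fs k hk * fs k hk) 1
  | s_braid (k : ℕ) (hk : k + 1 < m) (hk' : k + 1 + 1 < m) :
      DegHeckeRel m (fs k hk * fs (k + 1) hk' * fs k hk)
        (fs (k + 1) hk' * fs k hk * fs (k + 1) hk')
  | s_comm (k l : ℕ) (hk : k + 1 < m) (hl : l + 1 < m) (h : k + 1 < l ∨ l + 1 < k) :
      DegHeckeRel m (fs k hk * fs l hl) (fs l hl * fs k hk)
  | s_u (k : ℕ) (hk : k + 1 < m) :
      DegHeckeRel m (fs k hk * fu k (Nat.lt_of_succ_lt hk)) (fu (k + 1) hk * fs k hk + 1)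
  | s_u_comm (k l : ℕ) (hk : k + 1 < m) (hl : l < m) (h : l ≠ k) (h' : l ≠ k + 1) :
      DegHeckeRel m (fs k hk * fu l hl) (fu l hl * fs k hk)
  | u_comm (k l : ℕ) (hk : k < m) (hl : l < m) :
      DegHeckeRel m (fu k hk * fu l hl) (fu l hl * fu k hk)

/-- The degenerate affine Hecke algebra `H_m` over `ℂ`. -/
abbrev DegHecke (m : ℕ) : Type := RingQuot (DegHeckeRel m)

namespace DegHecke

/-- The element `s_k` of `H_m`. -/
noncomputable def s {m : ℕ} (k : ℕ) (hk : k + 1 < m) : DegHecke m :=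
  RingQuot.mkAlgHom ℂ (DegHeckeRel m) (DegHeckeGen.fs k hk)

/-- The element `u_k` of `H_m`. -/
noncomputable def u {m : ℕ} (k : ℕ) (hk : k < m) : DegHecke m :=
  RingQuot.mkAlgHom ℂ (DegHeckeRel m) (DegHeckeGen.fu k hk)

end DegHecke

/-- The adjacent transposition `(k, k + 1)` as an element of `ℂ[S(n)]`. -/
noncomputable def adjTransp {n : ℕ} (k : ℕ) (hk : k + 1 < n) :
    MonoidAlgebra ℂ (Equiv.Perm (Fin n)) :=
  permElt (Equiv.swap ⟨k, Nat.lt_of_succ_lt hk⟩ ⟨k + 1, hk⟩)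

/-- The Jucys–Murphy element `∑_{i > k} (k i)` of `ℂ[S(n)]`. -/
noncomputable def jucysMurphy {n : ℕ} (k : ℕ) (hk : k < n) :
    MonoidAlgebra ℂ (Equiv.Perm (Fin n)) :=
  ∑ i ∈ Finset.Ioi (⟨k, hk⟩ : Fin n), permElt (Equiv.swap ⟨k, hk⟩ i)

/-! ### Conjugation by permutations that fix the lower points -/

section Permutations

open Equiv

/-! Call points of index below `m` lower and the others upper. Since averaging over `S_m(n)`
projects onto `B_m(n)`, this algebra is spanned by the sums `conjSum m` of `S_m(n)`-conjugates of
single permutations. Filter them by the number of upper points moved.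

If σ and τ move disjoint sets of upper points, the product of their conjugate sums is a positive
multiple of the conjugate sum of `σ * τ`, plus terms moving fewer upper points (`conjSum_mul_mem`).
By induction on this number it remains to factor permutations. If σ sends a lower `a` to an upper
`i`, split off `swap a i`, whose conjugate sum comes from a Jucys–Murphy element
(`conjSum_swap_mem`). Otherwise σ is a permutation of lower points, a product of adjacent
transpositions, times one of upper points. For the latter, project its full class sum, which is
central, to `B_m(n)`: conjugates moving a lower point move fewer upper ones
(`conjSum_mem_of_center_le`).

The homomorphism exists because the Hecke relations hold in the group algebra. -/

theorem mem_symmFix {m n : ℕ} {σ : Perm (Fin n)} :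
    σ ∈ symmFix m n ↔ ∀ i : Fin n, (i : ℕ) < m → σ i = i := by
  simp [symmFix, mem_fixingSubgroup_iff]

theorem Equiv.Perm.exists_eqOn_of_injOn {α : Type*} [Finite α] {T : Set α} {f : α → α}
    (hf : Set.InjOn f T) : ∃ k : Perm α, Set.EqOn k f T := by
  classical
  have := Fintype.ofFinite α
  obtain ⟨g, hg⟩ := Finset.exists_equiv_extend_of_card_eq (t := (Finset.univ : Finset α))
    (s := T.toFinset) (f := f) (by simp) (by simp) (by simpa using hf)
  refine ⟨g.trans (Equiv.subtypeUnivEquiv (by simp)), fun x hx => ?_⟩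
  simpa using hg x (by simpa using hx)

/-- `g⁻¹ * k` fixes every point moved by σ, so it is disjoint from σ and commutes with it. -/
theorem Equiv.Perm.conj_eq_conj_of_eqOn_support {α : Type*} {σ g k : Perm α}
    (h : ∀ x, σ x ≠ x → k x = g x) : k * σ * k⁻¹ = g * σ * g⁻¹ := by
  have hd : Perm.Disjoint (g⁻¹ * k) σ := fun x => by
    by_cases hx : σ x = x
    · exact Or.inr hx
    · left
      simp [h x hx]
  have hc : g⁻¹ * k * σ = σ * (g⁻¹ * k) := hd.commute
  calc k * σ * k⁻¹ = g * (g⁻¹ * k * σ) * k⁻¹ := by group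
    _ = g * σ * g⁻¹ := by rw [hc]; group

/-- The points of index at least `m` that are moved by `σ`. -/
def upperSupport (m : ℕ) {n : ℕ} (σ : Perm (Fin n)) : Finset (Fin n) :=
  Finset.univ.filter fun i => m ≤ (i : ℕ) ∧ σ i ≠ i

theorem mem_upperSupport {m n : ℕ} {σ : Perm (Fin n)} {i : Fin n} :
    i ∈ upperSupport m σ ↔ m ≤ (i : ℕ) ∧ σ i ≠ i := by
  simp [upperSupport]

theorem le_apply_of_mem_symmFix {m n : ℕ} {k : Perm (Fin n)} (hk : k ∈ symmFix m n)
    {i : Fin n} (hi : m ≤ (i : ℕ)) : m ≤ (k i : ℕ) := by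
  by_contra h
  have := k.injective (mem_symmFix.1 hk (k i) (by omega))
  rw [this] at h
  exact h hi

theorem upperSupport_mul_conj_subset {m n : ℕ} {k : Perm (Fin n)} (hk : k ∈ symmFix m n)
    (σ τ : Perm (Fin n)) :
    upperSupport m (σ * (k * τ * k⁻¹)) ⊆
      upperSupport m σ ∪ (upperSupport m τ).image k := by
  intro i hi
  rw [mem_upperSupport] at hi
  rw [Finset.mem_union, mem_upperSupport, Finset.mem_image]
  by_cases h : τ (k⁻¹ i) = k⁻¹ i
  · left
    refine ⟨hi.1, ?_⟩
    have h2 : σ (k (τ (k⁻¹ i))) ≠ i := hi.2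
    rw [h] at h2
    simpa using h2
  · right
    refine ⟨k⁻¹ i, mem_upperSupport.2 ⟨?_, h⟩, by simp⟩
    exact le_apply_of_mem_symmFix (inv_mem hk) hi.1

/-- If `σ` and `k τ k⁻¹`, as well as `σ` and `τ`, move disjoint sets of upper points, then the
products `σ (k τ k⁻¹)` and `σ τ` are conjugate under `S_m(n)`. -/
theorem exists_conj_mul_eq {m n : ℕ} {σ τ k : Perm (Fin n)} (hk : k ∈ symmFix m n)
    (hd : Disjoint (upperSupport m σ) (upperSupport m τ))
    (hdk : Disjoint (upperSupport m σ) ((upperSupport m τ).image k)) :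
    ∃ g ∈ symmFix m n, g * (σ * τ) * g⁻¹ = σ * (k * τ * k⁻¹) := by
  classical
  have hk' := mem_symmFix.1 hk
  have hd1 : ∀ x : Fin n, m ≤ (x : ℕ) → σ x ≠ x → τ x = x := fun x hx h => by
    by_contra h'
    exact Finset.disjoint_left.1 hd (mem_upperSupport.2 ⟨hx, h⟩) (mem_upperSupport.2 ⟨hx, h'⟩)
  have hd2 : ∀ x : Fin n, m ≤ (x : ℕ) → τ x ≠ x → σ (k x) = k x := fun x hx h => by
    by_contra h'
    exact Finset.disjoint_left.1 hdk
      (mem_upperSupport.2 ⟨le_apply_of_mem_symmFix hk hx, h'⟩)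
      (Finset.mem_image_of_mem _ (mem_upperSupport.2 ⟨hx, h⟩))
  -- The conjugator `g` should act as `k` on points moved by τ and as the identity on the other
  -- lower points and points moved by σ. This is the mixed case of the injectivity of that
  -- prescription.
  have key : ∀ x y : Fin n, τ x ≠ x → ((y : ℕ) < m ∨ σ y ≠ y) → k x = y → x = y := by
    intro x y hx hy hxy
    by_cases hym : (y : ℕ) < m
    · exact k.injective (hxy.trans (hk' y hym).symm)
    · have hy := hy.resolve_left hym
      by_cases hxm : (x : ℕ) < m
      · rw [← hxy, hk' x hxm]
      · exact absurd (hxy ▸ hd2 x (by omega) hx) hy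
  obtain ⟨g, hg⟩ := Perm.exists_eqOn_of_injOn
    (T := {x : Fin n | (x : ℕ) < m ∨ σ x ≠ x ∨ τ x ≠ x})
    (f := fun x => if τ x = x then x else k x) (by
      intro x hx y hy hxy
      simp only at hxy
      simp only [Set.mem_ofPred_eq] at hx hy
      split_ifs at hxy with h1 h2 h2
      · exact hxy
      · exact (key y x h2 (by tauto) hxy.symm).symm
      · exact key x y h1 (by tauto) hxy
      · exact k.injective hxy)
  have hgm : g ∈ symmFix m n := mem_symmFix.2 fun i hi => by
    rw [hg (Or.inl hi)]
    simp [hk' i hi]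
  refine ⟨g, hgm, ?_⟩
  -- A point moved by both σ and τ is lower, hence fixed by `k`.
  have e1 : g * σ * g⁻¹ = 1 * σ * 1⁻¹ := Perm.conj_eq_conj_of_eqOn_support fun x hx => by
    rw [hg (Or.inr (Or.inl hx))]
    simp only [Perm.coe_one, id_eq, ite_eq_left_iff]
    intro h
    by_cases hxm : (x : ℕ) < m
    · exact hk' x hxm
    · exact absurd (hd1 x (by omega) hx) h
  have e2 : g * τ * g⁻¹ = k * τ * k⁻¹ := Perm.conj_eq_conj_of_eqOn_support fun x hx => by
    rw [hg (Or.inr (Or.inr hx))]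
    simp [hx]
  calc g * (σ * τ) * g⁻¹ = (g * σ * g⁻¹) * (g * τ * g⁻¹) := by group
    _ = _ := by rw [e1, e2]; simp

/-- If `σ` moves only upper points and so does its conjugate by `g`, then this conjugate is already
a conjugate under `S_m(n)`. -/
theorem exists_symmFix_conj_eq {m n : ℕ} {σ g : Perm (Fin n)}
    (hσ : ∀ i : Fin n, (i : ℕ) < m → σ i = i)
    (hg : ∀ i : Fin n, (i : ℕ) < m → (g * σ * g⁻¹) i = i) :
    ∃ k ∈ symmFix m n, k * σ * k⁻¹ = g * σ * g⁻¹ := by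
  classical
  have hg' : ∀ x, σ x ≠ x → m ≤ (g x : ℕ) := fun x hx => by
    by_contra h
    exact hx (by simpa using hg (g x) (by omega))
  obtain ⟨k, hk⟩ := Perm.exists_eqOn_of_injOn
    (T := {x : Fin n | (x : ℕ) < m ∨ σ x ≠ x})
    (f := fun x => if σ x = x then x else g x) (by
      intro x hx y hy hxy
      simp only at hxy
      simp only [Set.mem_ofPred_eq] at hx hy
      split_ifs at hxy with h1 h2 h2
      · exact hxy
      · have := hg' y h2
        rw [← hxy] at this
        omega
      · have := hg' x h1
        rw [hxy] at this
        omega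
      · exact g.injective hxy)
  refine ⟨k, mem_symmFix.2 fun i hi => ?_, Perm.conj_eq_conj_of_eqOn_support fun x hx => ?_⟩
  · rw [hk (Or.inl hi)]
    simp [hσ i hi]
  · rw [hk (Or.inr hx)]
    simp [hx]

end Permutations

/-! ### Averaging over `S_m(n)` -/

section Averaging

open Equiv

theorem permElt_mul {n : ℕ} (σ τ : Perm (Fin n)) : permElt (σ * τ) = permElt σ * permElt τ :=
  map_mul _ _ _

@[simp]
theorem permElt_one {n : ℕ} : permElt (1 : Perm (Fin n)) = 1 :=
  map_one _

theorem permElt_conj {n : ℕ} (g σ : Perm (Fin n)) :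
    permElt g * permElt σ * permElt g⁻¹ = permElt (g * σ * g⁻¹) := by
  simp only [permElt_mul]

theorem mem_centralizerAlg {m n : ℕ} {x : MonoidAlgebra ℂ (Perm (Fin n))} :
    x ∈ centralizerAlg m n ↔ ∀ g ∈ symmFix m n, permElt g * x = x * permElt g := by
  simp [centralizerAlg, Subalgebra.mem_centralizer_iff]

open scoped Classical in
/-- The sum of the conjugates of an element of `ℂ[S(n)]` by the elements of `S_m(n)`. -/
noncomputable def conjSum (m : ℕ) {n : ℕ} :
    MonoidAlgebra ℂ (Perm (Fin n)) →ₗ[ℂ] MonoidAlgebra ℂ (Perm (Fin n)) :=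
  ∑ g : symmFix m n, LinearMap.mulLeftRight ℂ
    (permElt (g : Perm (Fin n)), permElt (g : Perm (Fin n))⁻¹)

open scoped Classical in
theorem conjSum_apply {m n : ℕ} (x : MonoidAlgebra ℂ (Perm (Fin n))) :
    conjSum m x =
      ∑ g : symmFix m n, permElt (g : Perm (Fin n)) * x * permElt (g : Perm (Fin n))⁻¹ := by
  simp [conjSum, LinearMap.sum_apply]

theorem conjSum_of_mem {m n : ℕ} {x : MonoidAlgebra ℂ (Perm (Fin n))}
    (hx : x ∈ centralizerAlg m n) : conjSum m x = (Nat.card (symmFix m n) : ℂ) • x := by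
  classical
  have h : ∀ g : symmFix m n,
      permElt (g : Perm (Fin n)) * x * permElt (g : Perm (Fin n))⁻¹ = x := fun g => by
    rw [mem_centralizerAlg.1 hx g g.2, mul_assoc, ← permElt_mul]
    simp
  rw [conjSum_apply, Finset.sum_congr rfl fun g _ => h g]
  simp [Nat.cast_smul_eq_nsmul]

theorem conjSum_conj {m n : ℕ} {h : Perm (Fin n)} (hh : h ∈ symmFix m n)
    (x : MonoidAlgebra ℂ (Perm (Fin n))) :
    conjSum m (permElt h * x * permElt h⁻¹) = conjSum m x := by
  classical
  rw [conjSum_apply, conjSum_apply]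
  refine Fintype.sum_equiv (Equiv.mulRight (⟨h, hh⟩ : symmFix m n)) _ _ fun g => ?_
  simp [permElt_mul, mul_assoc]

theorem conjSum_permElt_conj {m n : ℕ} {h : Perm (Fin n)} (hh : h ∈ symmFix m n)
    (σ : Perm (Fin n)) : conjSum m (permElt (h * σ * h⁻¹)) = conjSum m (permElt σ) := by
  rw [← permElt_conj, conjSum_conj hh]

theorem conjSum_mem {m n : ℕ} (x : MonoidAlgebra ℂ (Perm (Fin n))) :
    conjSum m x ∈ centralizerAlg m n := by
  classical
  rw [mem_centralizerAlg]
  intro h hh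
  rw [conjSum_apply, Finset.mul_sum, Finset.sum_mul]
  refine Fintype.sum_equiv (Equiv.mulLeft (⟨h, hh⟩ : symmFix m n)) _ _ fun g => ?_
  simp only [coe_mulLeft, Subgroup.coe_mul, mul_inv_rev, permElt_mul, mul_assoc]
  rw [← permElt_mul h⁻¹ h]
  simp

open scoped Classical in
-- In the double sum over `g` and `h`, substitute `h = g * k` and pull out conjugation by `g`.
theorem conjSum_mul_conjSum {m n : ℕ} (σ τ : Perm (Fin n)) :
    conjSum m (permElt σ) * conjSum m (permElt τ) =
      ∑ k : symmFix m n,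
        conjSum m (permElt (σ * ((k : Perm (Fin n)) * τ * (k : Perm (Fin n))⁻¹))) := by
  simp only [conjSum_apply, Finset.sum_mul_sum]
  rw [Finset.sum_comm (γ := symmFix m n)]
  conv_rhs => rw [Finset.sum_comm]
  rw [Finset.sum_comm]
  refine Finset.sum_congr rfl fun g _ => ?_
  refine Fintype.sum_equiv (Equiv.mulLeft g⁻¹) _ _ fun k => ?_
  simp only [← permElt_mul]
  congr 1
  simp only [coe_mulLeft, Subgroup.coe_mul, Subgroup.coe_inv]
  group

end Averaging

/-! ### The Hecke relations in the group algebra -/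

section Homomorphism

open Equiv

theorem permElt_mul_jucysMurphy {n : ℕ} (σ : Perm (Fin n)) (k : ℕ) (hk : k < n) :
    permElt σ * jucysMurphy k hk =
      (∑ i ∈ Finset.Ioi (⟨k, hk⟩ : Fin n), permElt (swap (σ ⟨k, hk⟩) (σ i))) * permElt σ := by
  rw [jucysMurphy, Finset.mul_sum, Finset.sum_mul]
  refine Finset.sum_congr rfl fun i _ => ?_
  rw [← permElt_mul, ← permElt_mul, mul_swap_eq_swap_mul]

/-- Conjugation by σ permutes the summands `(k i)`. -/
theorem permElt_commute_jucysMurphy {n : ℕ} {σ : Perm (Fin n)} {k : ℕ} {hk : k < n}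
    (h : σ ⟨k, hk⟩ = ⟨k, hk⟩) (h' : ∀ i : Fin n, k < (i : ℕ) → k < (σ i : ℕ)) :
    permElt σ * jucysMurphy k hk = jucysMurphy k hk * permElt σ := by
  rw [permElt_mul_jucysMurphy, jucysMurphy, h]
  congr 1
  have hmaps : ∀ i ∈ Finset.Ioi (⟨k, hk⟩ : Fin n), σ i ∈ Finset.Ioi (⟨k, hk⟩ : Fin n) := by
    intro i hi
    rw [Finset.mem_Ioi, Fin.lt_def] at hi ⊢
    exact h' i hi
  refine Finset.sum_bij (fun i _ => σ i) hmaps (fun _ _ _ _ e => σ.injective e) ?_ fun _ _ => rfl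
  intro b hb
  obtain ⟨a, ha, e⟩ := Finset.surj_on_of_inj_on_of_card_le (fun i _ => σ i) hmaps
    (fun _ _ _ _ e => σ.injective e) le_rfl b hb
  exact ⟨a, ha, e.symm⟩

theorem jucysMurphy_mem {m n : ℕ} {k : ℕ} (hk : k < n) (hkm : k < m) :
    jucysMurphy k hk ∈ centralizerAlg m n := by
  rw [mem_centralizerAlg]
  intro g hg
  refine permElt_commute_jucysMurphy (mem_symmFix.1 hg _ hkm) fun i hi => ?_
  by_cases him : (i : ℕ) < m
  · rwa [mem_symmFix.1 hg i him]
  · have := le_apply_of_mem_symmFix hg (i := i) (by omega)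
    omega

theorem permElt_mem {m n : ℕ} {σ : Perm (Fin n)} (h : ∀ i : Fin n, m ≤ (i : ℕ) → σ i = i) :
    permElt σ ∈ centralizerAlg m n := by
  rw [mem_centralizerAlg]
  intro g hg
  have hd : Perm.Disjoint g σ := fun x => by
    by_cases hx : (x : ℕ) < m
    · exact Or.inl (mem_symmFix.1 hg x hx)
    · exact Or.inr (h x (by omega))
  rw [← permElt_mul, ← permElt_mul, hd.commute]

theorem swap_val_apply_of_ne {n : ℕ} {a b i : Fin n} (ha : (i : ℕ) ≠ a) (hb : (i : ℕ) ≠ b) :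
    swap a b i = i :=
  swap_apply_of_ne_of_ne (Fin.val_ne_iff.1 ha) (Fin.val_ne_iff.1 hb)

theorem permElt_swap_mem {m n : ℕ} {a b : Fin n} (ha : (a : ℕ) < m) (hb : (b : ℕ) < m) :
    permElt (swap a b) ∈ centralizerAlg m n :=
  permElt_mem fun _ hi => swap_val_apply_of_ne (by omega) (by omega)

theorem adjTransp_mem {m n : ℕ} {k : ℕ} (hk : k + 1 < n) (hkm : k + 1 < m) :
    adjTransp k hk ∈ centralizerAlg m n :=
  permElt_swap_mem (by simp; omega) hkm

theorem jucysMurphy_commute {n k l : ℕ} (hk : k < n) (hl : l < n) :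
    jucysMurphy k hk * jucysMurphy l hl = jucysMurphy l hl * jucysMurphy k hk := by
  wlog hkl : k < l generalizing k l
  · rcases (not_lt.1 hkl).eq_or_lt with rfl | h
    · rfl
    · exact (this hl hk h).symm
  conv_lhs => rw [jucysMurphy.eq_def l hl, Finset.mul_sum]
  conv_rhs => rw [jucysMurphy.eq_def l hl, Finset.sum_mul]
  refine Finset.sum_congr rfl fun i hi => ?_
  rw [Finset.mem_Ioi, Fin.lt_def] at hi
  simp only at hi
  refine (permElt_commute_jucysMurphy (swap_val_apply_of_ne (by simp; omega) (by simp; omega))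
    fun j hj => ?_).symm
  by_cases h1 : j = ⟨l, hl⟩
  · rw [h1, swap_apply_left]
    omega
  · by_cases h2 : j = i
    · rwa [h2, swap_apply_right]
    · rwa [swap_apply_of_ne_of_ne h1 h2]

theorem adjTransp_commute_jucysMurphy {n k l : ℕ} (hk : k + 1 < n) (hl : l < n) (h : l ≠ k)
    (h' : l ≠ k + 1) :
    adjTransp k hk * jucysMurphy l hl = jucysMurphy l hl * adjTransp k hk := by
  refine permElt_commute_jucysMurphy (swap_val_apply_of_ne h h') fun j hj => ?_
  by_cases h1 : j = ⟨k, by omega⟩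
  · rw [h1, swap_apply_left]
    rw [h1] at hj
    simp only at hj ⊢
    omega
  · by_cases h2 : j = ⟨k + 1, hk⟩
    · rw [h2, swap_apply_right]
      rw [h2] at hj
      simp only at hj ⊢
      omega
    · rwa [swap_apply_of_ne_of_ne h1 h2]

theorem adjTransp_mul_self {n k : ℕ} (hk : k + 1 < n) : adjTransp k hk * adjTransp k hk = 1 := by
  rw [adjTransp, ← permElt_mul, swap_mul_self, permElt_one]

/-- Conjugation turns `(k i)` into `(k+1 i)` for `i > k + 1`; the remaining summand `(k k+1)`
squares to the term 1. -/
theorem adjTransp_mul_jucysMurphy {n k : ℕ} (hk : k + 1 < n) :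
    adjTransp k hk * jucysMurphy k (Nat.lt_of_succ_lt hk) =
      jucysMurphy (k + 1) hk * adjTransp k hk + 1 := by
  have hI : Finset.Ioi (⟨k, Nat.lt_of_succ_lt hk⟩ : Fin n) =
      insert ⟨k + 1, hk⟩ (Finset.Ioi ⟨k + 1, hk⟩) := by
    ext i
    simp only [Finset.mem_insert, Finset.mem_Ioi, Fin.lt_def, Fin.ext_iff]
    omega
  conv_lhs => rw [adjTransp, permElt_mul_jucysMurphy, swap_apply_left, hI,
    Finset.sum_insert (by simp), swap_apply_right, add_mul, add_comm]
  congr 1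
  · rw [jucysMurphy, adjTransp]
    congr 1
    refine Finset.sum_congr rfl fun i hi => ?_
    rw [Finset.mem_Ioi, Fin.lt_def] at hi
    simp only at hi
    rw [swap_val_apply_of_ne (by simp; omega) (by simp; omega)]
  · rw [swap_comm, ← adjTransp]
    exact adjTransp_mul_self hk

theorem adjTransp_braid {n k : ℕ} (hk : k + 1 < n) (hk' : k + 1 + 1 < n) :
    adjTransp k hk * adjTransp (k + 1) hk' * adjTransp k hk =
      adjTransp (k + 1) hk' * adjTransp k hk * adjTransp (k + 1) hk' := by
  simp only [adjTransp, ← permElt_mul]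
  have key : ∀ a b c : Fin n, a ≠ b → a ≠ c → b ≠ c →
      swap a b * swap b c * swap a b = swap b c * swap a b * swap b c := by
    intro a b c hab hac hbc
    have h := swap_mul_swap_mul_swap hbc.symm hac.symm
    rw [swap_comm b a, swap_comm c b] at h
    rw [h, swap_mul_swap_mul_swap hab hac, swap_comm]
  rw [key _ _ _ (by simp) (by simp [Fin.ext_iff]; omega) (by simp)]

theorem adjTransp_commute {n k l : ℕ} (hk : k + 1 < n) (hl : l + 1 < n)
    (h : k + 1 < l ∨ l + 1 < k) :
    adjTransp k hk * adjTransp l hl = adjTransp l hl * adjTransp k hk := by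
  simp only [adjTransp, ← permElt_mul]
  rw [mul_swap_eq_swap_mul, swap_val_apply_of_ne (by simp; omega) (by simp; omega),
    swap_val_apply_of_ne (by simp; omega) (by simp; omega)]

/-- The images of the generators of `H_m` in `B_m(n)`. -/
noncomputable def degHeckeGenImage {m n : ℕ} (hmn : m ≤ n) : DegHeckeGen m → centralizerAlg m n
  | .s k hk => ⟨adjTransp k (lt_of_lt_of_le hk hmn), adjTransp_mem _ hk⟩
  | .u k hk => ⟨jucysMurphy k (lt_of_lt_of_le hk hmn), jucysMurphy_mem _ hk⟩

/-- The homomorphism from the degenerate affine Hecke algebra `H_m` to `B_m(n)`. -/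
noncomputable def degHeckeHom {m n : ℕ} (hmn : m ≤ n) : DegHecke m →ₐ[ℂ] centralizerAlg m n :=
  RingQuot.liftAlgHom ℂ ⟨FreeAlgebra.lift ℂ (degHeckeGenImage hmn), by
    intro x y hxy
    apply Subtype.ext
    cases hxy <;>
      simp only [DegHeckeGen.fs, DegHeckeGen.fu, map_mul, map_add, map_one,
        FreeAlgebra.lift_ι_apply, degHeckeGenImage, MulMemClass.coe_mul, AddMemClass.coe_add,
        OneMemClass.coe_one]
    · exact adjTransp_mul_self _
    · exact adjTransp_braid _ _
    · exact adjTransp_commute _ _ (by assumption)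
    · exact adjTransp_mul_jucysMurphy _
    · exact adjTransp_commute_jucysMurphy _ _ (by assumption) (by assumption)
    · exact jucysMurphy_commute _ _⟩

theorem degHeckeHom_s {m n : ℕ} (hmn : m ≤ n) (k : ℕ) (hk : k + 1 < m) :
    (degHeckeHom hmn (DegHecke.s k hk) : MonoidAlgebra ℂ (Perm (Fin n))) =
      adjTransp k (lt_of_lt_of_le hk hmn) := by
  simp [degHeckeHom, DegHecke.s, DegHeckeGen.fs, degHeckeGenImage]

theorem degHeckeHom_u {m n : ℕ} (hmn : m ≤ n) (k : ℕ) (hk : k < m) :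
    (degHeckeHom hmn (DegHecke.u k hk) : MonoidAlgebra ℂ (Perm (Fin n))) =
      jucysMurphy k (lt_of_lt_of_le hk hmn) := by
  simp [degHeckeHom, DegHecke.u, DegHeckeGen.fu, degHeckeGenImage]

theorem DegHecke.algHom_ext {m : ℕ} {B : Type*} [Semiring B] [Algebra ℂ B]
    {φ ψ : DegHecke m →ₐ[ℂ] B} (hs : ∀ k hk, φ (DegHecke.s k hk) = ψ (DegHecke.s k hk))
    (hu : ∀ k hk, φ (DegHecke.u k hk) = ψ (DegHecke.u k hk)) : φ = ψ := by
  apply RingQuot.ringQuot_ext'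
  apply FreeAlgebra.hom_ext
  funext x
  cases x with
  | s k hk => exact hs k hk
  | u k hk => exact hu k hk

end Homomorphism

/-! ### Generation by induction on the number of moved upper points -/

section Generation

open Equiv

theorem Subalgebra.mem_of_smul_mem {K A : Type*} [Field K] [Ring A] [Algebra K A]
    {S : Subalgebra K A} {c : K} (hc : c ≠ 0) {x : A} (h : c • x ∈ S) : x ∈ S := by
  simpa [smul_smul, inv_mul_cancel₀ hc] using S.smul_mem h c⁻¹

theorem card_symmFix_ne_zero (m n : ℕ) : (Nat.card (symmFix m n) : ℂ) ≠ 0 :=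
  Nat.cast_ne_zero.2 Nat.card_pos.ne'

theorem centralizerAlg_le_of_conjSum_mem {m n : ℕ}
    {A : Subalgebra ℂ (MonoidAlgebra ℂ (Perm (Fin n)))}
    (h : ∀ σ, conjSum m (permElt σ) ∈ A) : centralizerAlg m n ≤ A := by
  intro x hx
  refine Subalgebra.mem_of_smul_mem (card_symmFix_ne_zero m n) ?_
  rw [← conjSum_of_mem hx]
  clear hx
  induction x using MonoidAlgebra.induction_on with
  | of σ => exact h σ
  | add x y hx hy => rw [map_add]; exact add_mem hx hy
  | smul r x hx => rw [map_smul]; exact A.smul_mem hx r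

theorem conjSum_mul_mem {m n : ℕ} {A : Subalgebra ℂ (MonoidAlgebra ℂ (Perm (Fin n)))}
    {σ τ : Perm (Fin n)} (hd : Disjoint (upperSupport m σ) (upperSupport m τ))
    (hσ : conjSum m (permElt σ) ∈ A) (hτ : conjSum m (permElt τ) ∈ A)
    (hlt : ∀ ρ : Perm (Fin n), (upperSupport m ρ).card <
      (upperSupport m σ).card + (upperSupport m τ).card → conjSum m (permElt ρ) ∈ A) :
    conjSum m (permElt (σ * τ)) ∈ A := by
  classical
  set P : symmFix m n → Prop := fun k =>
    Disjoint (upperSupport m σ) ((upperSupport m τ).image (k : Perm (Fin n))) with hP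
  have hprod := conjSum_mul_conjSum (m := m) σ τ
  rw [← Finset.sum_filter_add_sum_filter_not Finset.univ P] at hprod
  have hgood : ∀ k ∈ Finset.univ.filter P,
      conjSum m (permElt (σ * ((k : Perm (Fin n)) * τ * (k : Perm (Fin n))⁻¹))) =
        conjSum m (permElt (σ * τ)) := fun k hk => by
    obtain ⟨g, hg, e⟩ := exists_conj_mul_eq k.2 hd (Finset.mem_filter.1 hk).2
    rw [← e, conjSum_permElt_conj hg]
  -- When the two sets of upper points overlap, their union is strictly smaller than the sum of the
  -- sizes.
  have hbad : (∑ k ∈ Finset.univ.filter fun k => ¬ P k,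
      conjSum m (permElt (σ * ((k : Perm (Fin n)) * τ * (k : Perm (Fin n))⁻¹)))) ∈ A := by
    refine sum_mem fun k hk => hlt _ ?_
    refine (Finset.card_le_card (upperSupport_mul_conj_subset k.2 σ τ)).trans_lt ?_
    rw [← Finset.card_image_of_injective (upperSupport m τ) (k : Perm (Fin n)).injective]
    refine lt_of_le_of_ne (Finset.card_union_le _ _) fun e => ?_
    exact (Finset.mem_filter.1 hk).2 (Finset.card_union_eq_card_add_card.1 e)
  rw [Finset.sum_congr rfl hgood, Finset.sum_const, ← Nat.cast_smul_eq_nsmul ℂ] at hprod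
  refine Subalgebra.mem_of_smul_mem (c := ((Finset.univ.filter P).card : ℂ)) ?_ ?_
  -- `k = 1` is a good index by `hd`, so the coefficient is nonzero.
  · refine Nat.cast_ne_zero.2 (Finset.card_pos.2 ⟨1, ?_⟩).ne'
    simpa [hP] using hd
  · rw [eq_sub_iff_add_eq.2 hprod.symm]
    exact sub_mem (mul_mem hσ hτ) hbad

theorem permElt_swap_mem_of_adjTransp_mem {m n : ℕ}
    {A : Subalgebra ℂ (MonoidAlgebra ℂ (Perm (Fin n)))}
    (hs : ∀ (k : ℕ) (hk : k + 1 < n), k + 1 < m → adjTransp k hk ∈ A)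
    {a b : Fin n} (ha : (a : ℕ) < m) (hb : (b : ℕ) < m) : permElt (swap a b) ∈ A := by
  wlog hab : a < b generalizing a b
  · rcases (not_lt.1 hab).eq_or_lt with rfl | h
    · simp [← Perm.one_def]
    · rw [swap_comm]
      exact this hb ha h
  obtain ⟨b, hbn⟩ := b
  induction b with
  | zero => exact absurd hab (by simp [Fin.lt_def])
  | succ b ih =>
    simp only at hb
    rw [Fin.lt_def] at hab
    simp only at hab
    by_cases h : (a : ℕ) = b
    · have : a = ⟨b, by omega⟩ := Fin.ext h
      rw [this]
      exact hs b hbn hb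
    · have h1 := ih (by omega) (by simp; omega) (by rw [Fin.lt_def]; simp only; omega)
      have h2 := hs b hbn hb
      have h3 := mul_mem (mul_mem h2 h1) h2
      rw [adjTransp, ← permElt_mul, ← permElt_mul,
        swap_mul_swap_mul_swap (by rw [Ne, Fin.ext_iff]; exact h)
          (by rw [Ne, Fin.ext_iff]; simp only; omega), swap_comm] at h3
      exact h3

theorem permElt_mem_of_swap_mem {m n : ℕ}
    {A : Subalgebra ℂ (MonoidAlgebra ℂ (Perm (Fin n)))}
    (hs : ∀ a b : Fin n, (a : ℕ) < m → (b : ℕ) < m → permElt (swap a b) ∈ A)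
    {σ : Perm (Fin n)} (h : ∀ i : Fin n, m ≤ (i : ℕ) → σ i = i) : permElt σ ∈ A := by
  have hlt : ∀ i : Fin n, (σ i : ℕ) < m ↔ (i : ℕ) < m := fun i => by
    by_cases hi : m ≤ (i : ℕ)
    · rw [h i hi]
    · refine iff_of_true ?_ (by omega)
      by_contra h'
      have := σ.injective (h (σ i) (by omega))
      rw [this] at h'
      omega
  obtain ⟨τ, rfl⟩ : ∃ τ : Perm {i : Fin n // (i : ℕ) < m}, Perm.ofSubtype τ = σ :=
    ⟨_, Perm.ofSubtype_subtypePerm (p := fun i : Fin n => (i : ℕ) < m) hlt fun i hi => by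
      by_contra h'
      exact hi (h i (by omega))⟩
  clear h hlt
  have hτ : τ ∈ Submonoid.closure {ρ : Perm {i : Fin n // (i : ℕ) < m} | ρ.IsSwap} := by
    rw [Perm.mclosure_isSwap]
    trivial
  induction hτ using Submonoid.closure_induction with
  | mem ρ hρ =>
    obtain ⟨a, b, -, rfl⟩ := hρ
    rw [Perm.ofSubtype_swap_eq]
    exact hs a b a.2 b.2
  | one => simp
  | mul ρ₁ ρ₂ _ _ h₁ h₂ =>
    rw [map_mul, permElt_mul]
    exact mul_mem h₁ h₂

/-- Removing the `(a j)` with `j` lower from the Jucys–Murphy element leaves the sum of `(a j)` over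
upper `j`. These are all `S_m(n)`-conjugate, so the remainder is a nonzero multiple of the conjugate
sum. -/
theorem conjSum_swap_mem {m n : ℕ} {A : Subalgebra ℂ (MonoidAlgebra ℂ (Perm (Fin n)))}
    (hs : ∀ a b : Fin n, (a : ℕ) < m → (b : ℕ) < m → permElt (swap a b) ∈ A)
    {a i : Fin n} (hu : jucysMurphy (a : ℕ) a.2 ∈ A) (ha : (a : ℕ) < m) (hi : m ≤ (i : ℕ)) :
    conjSum m (permElt (swap a i)) ∈ A := by
  have hsplit : jucysMurphy (a : ℕ) a.2 =
      (∑ j ∈ (Finset.Ioi a).filter (fun j : Fin n => (j : ℕ) < m), permElt (swap a j)) +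
        ∑ j ∈ (Finset.Ioi a).filter (fun j : Fin n => ¬ (j : ℕ) < m), permElt (swap a j) :=
    (Finset.sum_filter_add_sum_filter_not _ _ _).symm
  have hlow : ∀ (B : Subalgebra ℂ (MonoidAlgebra ℂ (Perm (Fin n)))),
      (∀ a b : Fin n, (a : ℕ) < m → (b : ℕ) < m → permElt (swap a b) ∈ B) →
      jucysMurphy (a : ℕ) a.2 ∈ B →
      (∑ j ∈ (Finset.Ioi a).filter (fun j : Fin n => ¬ (j : ℕ) < m), permElt (swap a j)) ∈ B := by
    intro B hB hB'
    rw [eq_sub_iff_add_eq'.2 hsplit.symm]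
    exact sub_mem hB' (sum_mem fun j hj => hB a j ha (Finset.mem_filter.1 hj).2)
  have hA := hlow A hs hu
  have hC := conjSum_of_mem (hlow (centralizerAlg m n) (fun _ _ => permElt_swap_mem)
    (jucysMurphy_mem _ ha))
  have heq : ∀ j ∈ (Finset.Ioi a).filter (fun j : Fin n => ¬ (j : ℕ) < m),
      conjSum m (permElt (swap a j)) = conjSum m (permElt (swap a i)) := fun j hj => by
    have hj := (Finset.mem_filter.1 hj).2
    have hg : swap i j ∈ symmFix m n := mem_symmFix.2 fun x hx =>
      swap_val_apply_of_ne (by omega) (by omega)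
    rw [← conjSum_permElt_conj hg (swap a i), ← swap_apply_apply, swap_apply_left,
      mem_symmFix.1 hg a ha]
  rw [map_sum, Finset.sum_congr rfl heq, Finset.sum_const, ← Nat.cast_smul_eq_nsmul ℂ] at hC
  refine Subalgebra.mem_of_smul_mem (c := (((Finset.Ioi a).filter
    (fun j : Fin n => ¬ (j : ℕ) < m)).card : ℂ)) ?_ (hC ▸ A.smul_mem hA _)
  refine Nat.cast_ne_zero.2 (Finset.card_pos.2 ⟨i, ?_⟩).ne'
  simp only [Finset.mem_filter, Finset.mem_Ioi, Fin.lt_def]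
  omega

/-- `g⁻¹` injects the points moved by the conjugate into those moved by σ, all upper; the moved
lower point supplies an image not coming from an upper point. -/
theorem card_upperSupport_conj {m n : ℕ} {σ : Perm (Fin n)}
    (hσ : ∀ i : Fin n, (i : ℕ) < m → σ i = i) (g : Perm (Fin n))
    (hg : ∃ i : Fin n, (i : ℕ) < m ∧ (g * σ * g⁻¹) i ≠ i) :
    (upperSupport m (g * σ * g⁻¹)).card < (upperSupport m σ).card := by
  classical
  obtain ⟨i, him, hi⟩ := hg
  have hmoved : ∀ j, (g * σ * g⁻¹) j ≠ j → σ (g⁻¹ j) ≠ g⁻¹ j := fun j hj e => hj (by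
    change g (σ (g⁻¹ j)) = j
    rw [e]
    simp)
  have hup : ∀ j, (g * σ * g⁻¹) j ≠ j → g⁻¹ j ∈ upperSupport m σ := fun j hj =>
    mem_upperSupport.2 ⟨by
      by_contra h
      exact hmoved j hj (hσ _ (by omega)), hmoved j hj⟩
  rw [← Finset.card_image_of_injective _ g⁻¹.injective]
  refine Finset.card_lt_card (Finset.ssubset_iff_subset_ne.2 ⟨fun x hx => ?_, fun e => ?_⟩)
  · obtain ⟨j, hj, rfl⟩ := Finset.mem_image.1 hx
    exact hup j (mem_upperSupport.1 hj).2
  · have := hup i hi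
    rw [← e] at this
    obtain ⟨j, hj, hji⟩ := Finset.mem_image.1 this
    rw [g⁻¹.injective hji] at hj
    have := (mem_upperSupport.1 hj).1
    omega

/-- Apply `conjSum m` to the central element `conjSum 0 (permElt σ)`, which it only rescales.
Conjugates fixing all lower points each contribute `conjSum m (permElt σ)`; the others fall under
`hlt`. -/
theorem conjSum_mem_of_center_le {m n : ℕ} {A : Subalgebra ℂ (MonoidAlgebra ℂ (Perm (Fin n)))}
    (hz : centralizerAlg 0 n ≤ A) {σ : Perm (Fin n)}
    (hσ : ∀ i : Fin n, (i : ℕ) < m → σ i = i)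
    (hlt : ∀ ρ : Perm (Fin n), (upperSupport m ρ).card < (upperSupport m σ).card →
      conjSum m (permElt ρ) ∈ A) :
    conjSum m (permElt σ) ∈ A := by
  classical
  have hzm : centralizerAlg 0 n ≤ centralizerAlg m n := fun x hx =>
    mem_centralizerAlg.2 fun g _ => mem_centralizerAlg.1 hx g (mem_symmFix.2 (by simp))
  have hc : conjSum 0 (permElt σ) ∈ centralizerAlg 0 n := conjSum_mem _
  have hsum := conjSum_of_mem (hzm hc)
  set P : symmFix 0 n → Prop := fun g =>
    ∀ i : Fin n, (i : ℕ) < m → ((g : Perm (Fin n)) * σ * (g : Perm (Fin n))⁻¹) i = i with hP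
  rw [conjSum_apply (m := 0), map_sum,
    ← Finset.sum_filter_add_sum_filter_not Finset.univ P, ← conjSum_apply] at hsum
  simp only [permElt_conj] at hsum
  have hgood : ∀ g ∈ Finset.univ.filter P,
      conjSum m (permElt ((g : Perm (Fin n)) * σ * (g : Perm (Fin n))⁻¹)) =
        conjSum m (permElt σ) := fun g hg => by
    obtain ⟨k, hk, e⟩ := exists_symmFix_conj_eq hσ (Finset.mem_filter.1 hg).2
    rw [← e, conjSum_permElt_conj hk]
  have hbad : (∑ g ∈ Finset.univ.filter fun g => ¬ P g,
      conjSum m (permElt ((g : Perm (Fin n)) * σ * (g : Perm (Fin n))⁻¹))) ∈ A := by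
    refine sum_mem fun g hg => hlt _ (card_upperSupport_conj hσ _ ?_)
    simpa only [hP, not_forall, exists_prop] using (Finset.mem_filter.1 hg).2
  rw [Finset.sum_congr rfl hgood, Finset.sum_const, ← Nat.cast_smul_eq_nsmul ℂ] at hsum
  refine Subalgebra.mem_of_smul_mem (c := ((Finset.univ.filter P).card : ℂ)) ?_ ?_
  · refine Nat.cast_ne_zero.2 (Finset.card_pos.2 ⟨1, ?_⟩).ne'
    simpa only [Finset.mem_filter, Finset.mem_univ, true_and, hP, Subgroup.coe_one, inv_one,
      one_mul, mul_one] using hσ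
  · rw [eq_sub_iff_add_eq.2 hsum]
    exact sub_mem (A.smul_mem (hz hc) _) hbad

theorem centralizerAlg_le {m n : ℕ} {A : Subalgebra ℂ (MonoidAlgebra ℂ (Perm (Fin n)))}
    (hz : centralizerAlg 0 n ≤ A)
    (hs : ∀ (k : ℕ) (hk : k + 1 < n), k + 1 < m → adjTransp k hk ∈ A)
    (hu : ∀ (k : ℕ) (hk : k < n), k < m → jucysMurphy k hk ∈ A) :
    centralizerAlg m n ≤ A := by
  have hsw : ∀ a b : Fin n, (a : ℕ) < m → (b : ℕ) < m → permElt (swap a b) ∈ A :=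
    fun _ _ => permElt_swap_mem_of_adjTransp_mem hs
  have hlow : ∀ σ : Perm (Fin n), (∀ i : Fin n, m ≤ (i : ℕ) → σ i = i) →
      conjSum m (permElt σ) ∈ A := fun σ h => by
    rw [conjSum_of_mem (permElt_mem h)]
    exact A.smul_mem (permElt_mem_of_swap_mem hsw h) _
  refine centralizerAlg_le_of_conjSum_mem fun σ => ?_
  induction hd : (upperSupport m σ).card using Nat.strong_induction_on generalizing σ with
  | _ d ih =>
  subst hd
  by_cases hpres : ∀ a : Fin n, (a : ℕ) < m → (σ a : ℕ) < m
  · have hiff : ∀ a : Fin n, (σ a : ℕ) < m ↔ (a : ℕ) < m := by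
      have hinj : Set.BijOn σ {a | (a : ℕ) < m} {a | (a : ℕ) < m} :=
        ((Set.toFinite _).injOn_iff_bijOn_of_mapsTo hpres).1 σ.injective.injOn
      refine fun a => ⟨fun h => ?_, hpres a⟩
      obtain ⟨b, hb, e⟩ := hinj.surjOn h
      exact σ.injective e ▸ hb
    set τ := Perm.ofSubtype (σ.subtypePerm (p := fun i : Fin n => (i : ℕ) < m) hiff) with hτ
    have hτl : ∀ i : Fin n, (i : ℕ) < m → τ i = σ i := fun i hi =>
      Perm.ofSubtype_subtypePerm_of_mem (p := fun i : Fin n => (i : ℕ) < m) hiff hi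
    have hτu : ∀ i : Fin n, m ≤ (i : ℕ) → τ i = i := fun i hi =>
      Perm.ofSubtype_subtypePerm_of_not_mem (p := fun i : Fin n => (i : ℕ) < m) hiff (by omega)
    set ρ := τ⁻¹ * σ with hρ
    have hρl : ∀ i : Fin n, (i : ℕ) < m → ρ i = i := fun i hi => by
      rw [hρ, Perm.mul_apply, ← hτl i hi]
      simp
    have hρu : ∀ i : Fin n, m ≤ (i : ℕ) → ρ i = σ i := fun i hi => by
      have := hiff i
      rw [hρ, Perm.mul_apply, Perm.inv_eq_iff_eq, hτu _ (by omega)]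
    have hτe : upperSupport m τ = ∅ := by
      ext i
      simp only [mem_upperSupport, Finset.notMem_empty, iff_false, not_and, not_not]
      exact hτu i
    have hρe : upperSupport m ρ = upperSupport m σ := by
      ext i
      simp only [mem_upperSupport]
      exact and_congr_right fun hi => by rw [hρu i hi]
    have hρA : conjSum m (permElt ρ) ∈ A := conjSum_mem_of_center_le hz hρl fun π hπ =>
      ih _ (hρe ▸ hπ) π rfl
    have := conjSum_mul_mem (σ := τ) (τ := ρ) (by simp [hτe]) (hlow τ hτu) hρA fun π hπ =>
      ih _ (by simpa [hτe, hρe] using hπ) π rfl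
    rwa [hρ, mul_inv_cancel_left] at this
  · push Not at hpres
    obtain ⟨a, ha, hi⟩ := hpres
    set i := σ a with hia
    have hne : a ≠ i := fun e => by rw [← e] at hi; omega
    -- This choice makes ρ fix `i` and agree with σ at all other upper points, so exactly one moved
    -- upper point is lost, the one `swap a i` moves.
    set ρ := σ * swap a i with hρ
    have hρσ : ρ * swap a i = σ := by rw [hρ, mul_assoc, swap_mul_self, mul_one]
    have hρi : ρ i = i := by rw [hρ, Perm.mul_apply, swap_apply_right]
    have hρe : upperSupport m ρ = (upperSupport m σ).erase i := by
      ext j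
      simp only [Finset.mem_erase, mem_upperSupport]
      by_cases hj : j = i
      · simp [hj, hρi]
      · simp only [hj, ne_eq, not_false_eq_true, true_and]
        refine and_congr_right fun hjm => ?_
        rw [hρ, Perm.mul_apply, swap_apply_of_ne_of_ne (fun e => by rw [e] at hjm; omega) hj]
    have hse : upperSupport m (swap a i) = {i} := by
      ext j
      simp only [mem_upperSupport, Finset.mem_singleton]
      constructor
      · rintro ⟨h1, h2⟩
        by_contra h3
        exact h2 (swap_apply_of_ne_of_ne (fun e => by rw [e] at h1; omega) h3)
      · rintro rfl
        exact ⟨hi, by rw [swap_apply_right]; exact hne⟩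
    have hiσ : i ∈ upperSupport m σ :=
      mem_upperSupport.2 ⟨hi, fun e => hne (σ.injective (e.trans hia)).symm⟩
    have hcard : (upperSupport m ρ).card + 1 = (upperSupport m σ).card := by
      rw [hρe, Finset.card_erase_add_one hiσ]
    rw [← hρσ]
    refine conjSum_mul_mem (by simp [hse, hρe]) (ih _ (by omega) ρ rfl)
      (conjSum_swap_mem hsw (hu a a.2 ha) ha hi) fun π hπ => ih _ ?_ π rfl
    rwa [hse, Finset.card_singleton, hcard] at hπ

end Generation

theorem corollary5p21 (m n : ℕ) (hmn : m ≤ n) :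
    ∃ φ : DegHecke m →ₐ[ℂ] centralizerAlg m n,
      ((∀ (k : ℕ) (hk : k + 1 < m),
          (φ (DegHecke.s k hk) : MonoidAlgebra ℂ (Equiv.Perm (Fin n))) =
            adjTransp k (lt_of_lt_of_le hk hmn)) ∧
        (∀ (k : ℕ) (hk : k < m),
          (φ (DegHecke.u k hk) : MonoidAlgebra ℂ (Equiv.Perm (Fin n))) =
            jucysMurphy k (lt_of_lt_of_le hk hmn))) ∧
      (∀ ψ : DegHecke m →ₐ[ℂ] centralizerAlg m n,
        (∀ (k : ℕ) (hk : k + 1 < m),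
          (ψ (DegHecke.s k hk) : MonoidAlgebra ℂ (Equiv.Perm (Fin n))) =
            adjTransp k (lt_of_lt_of_le hk hmn)) →
        (∀ (k : ℕ) (hk : k < m),
          (ψ (DegHecke.u k hk) : MonoidAlgebra ℂ (Equiv.Perm (Fin n))) =
            jucysMurphy k (lt_of_lt_of_le hk hmn)) →
        ψ = φ) ∧
      Algebra.adjoin ℂ
          ((centralizerAlg 0 n : Set (MonoidAlgebra ℂ (Equiv.Perm (Fin n)))) ∪
            Set.range (fun x : DegHecke m =>
              (φ x : MonoidAlgebra ℂ (Equiv.Perm (Fin n))))) =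
        centralizerAlg m n :=
 by
  refine ⟨degHeckeHom hmn, ⟨degHeckeHom_s hmn, degHeckeHom_u hmn⟩, fun ψ hs hu => ?_, ?_⟩
  · exact DegHecke.algHom_ext
      (fun k hk => Subtype.ext ((hs k hk).trans (degHeckeHom_s hmn k hk).symm))
      (fun k hk => Subtype.ext ((hu k hk).trans (degHeckeHom_u hmn k hk).symm))
  · refine le_antisymm (Algebra.adjoin_le ?_) (centralizerAlg_le ?_ ?_ ?_)
    · rintro x (hx | ⟨y, rfl⟩)
      · exact mem_centralizerAlg.2 fun g _ =>
          mem_centralizerAlg.1 hx g (mem_symmFix.2 (by simp))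
      · exact (degHeckeHom hmn y).2
    · exact fun x hx => Algebra.subset_adjoin (Or.inl hx)
    · exact fun k hk hkm => Algebra.subset_adjoin
        (Or.inr ⟨DegHecke.s k hkm, degHeckeHom_s hmn k hkm⟩)
    · exact fun k hk hkm => Algebra.subset_adjoin
        (Or.inr ⟨DegHecke.u k hkm, degHeckeHom_u hmn k hkm⟩)
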